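/- **Setting.** $\|\cdot\|$ is the Euclidean norm. Let $X\subseteq\mathbb R^n$, $U\subseteq\mathbb R^m$, $X_0\subseteq X$, and let $t$ be a stochastic kernel assigning to $(x,u)\in X\times U$ a probability measure $t(\cdot\,|\,x,u)$ on $X$. For $K=(K',b')\in\mathbb R^{m\times(n+1)}$ write $K(x)=K'x+b'$. Let $X=\bigcup_{i=1}^N q_i$, where the abstract states $q_i$ are $\infty$-norm balls of positive radius (each containing any measurable part of its boundary) with pairwise disjoint interiors, centers $\mathrm{ct}(q_i)$ and Euclidean diameter at most $\eta_q>0$; let $\mathrm{abs}:X\to\{q_1,\dots,q_N\}$ be measurable with $x\in\mathrm{abs}(x)$, and assume $t(q_i\cap q_j\,|\,x,u)=0$ for $i\neq j$ and all $(x,u)$. Let the controller space $\mathcal P^{K\times b}=\bigcup_{j=1}^M\mathcal P_j\subseteq\mathbb R^{m\times(n+1)}$ be partitioned in the same way into max-norm balls $\mathcal P_j$ with centers $\mathrm{ct}(\mathcal P_j)$ and max-norm diameter at most $\eta_{\mathcal P}>0$, where $\mathrm{ct}(\mathcal P_j)(\mathrm{ct}(q_i))\in U$ for all $i,j$. For all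 $q,\mathcal P$ let $NN_{(q,\mathcal P)}$ be a ReLU network with $NN_{(q,\mathcal P)}(q)\subseteq U$ and $NN_{(q,\mathcal P)}|_q\in\mathcal P$, i.e. it has a piecewise affine form on $X$, with finitely many polyhedral linear regions, such that the affine parameters on every linear region that meets $q$ lie in $\mathcal P$. Let $L:X\to 2^{AP}$ be a labeling that is constant on each set $\{\mathrm{abs}=q\}$, with value $\hat L(q)$. **Specification.** Let $\varphi$ be a BLTL or scLTL formula over $AP$ and $H\in\mathbb N$ a time horizon. A finite word satisfies $\varphi$ if all its infinite extensions do. Let $\mathcal A_\varphi=(S,S_0,2^{AP},G,\delta)$ be an equivalent deterministic automaton with $Z=|S|$ states: from each $s_0\in S_0$, a word of length $H+1$ drives it into $G$ at some point while it is read if and only if the word satisfies $\varphi$. **Planner.** Put $\hat t(q'|q,\mathcal P)=t(q'\,|\,z,\kappa(z))$ with $z=\mathrm{ct}(q)$, $\kappa=\mathrm{ct}(\mathcal P)$. Let $\hat V^*_H(q,s)=\mathbf 1_G(s)$ and, for $0\le k<H$, $\hat Q_k(q,s,\mathcal P)=\mathbf 1_G(s)+\mathbf 1_{S\setminus G}(s)\sum_{q'}\hat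 V^*_{k+1}(q',\delta(s,\hat L(q')))\,\hat t(q'|q,\mathcal P)$ and $\hat V^*_k(q,s)=\max_{\mathcal P}\hat Q_k(q,s,\mathcal P)$. At time $k<H$ in robot state $x$ and automaton state $s$, the planner applies the action $NN_{(q,\mathcal P^*)}(x)$, where $q=\mathrm{abs}(x)$ and $\mathcal P^*$ is a maximizer of $\hat Q_k(q,s,\cdot)$; then $x'\sim t(\cdot\,|\,x,u)$ and $s'=\delta(s,L(x'))$. Let $\xi^{(x,s)}$ be the closed-loop trajectory $x^{(0)}\dots x^{(H)}$ from $x^{(0)}=x$, $s^{(0)}=s$; it satisfies $\varphi$ if $L(x^{(0)})\dots L(x^{(H)})$ does. **Constants.** Let $\mu$ be a measure on $X$ and let $\lambda_i,\beta_i\ge0$ be $\mu$-integrable functions on $X$ such that, as inequalities between measures, $|t(dy|x',u)-t(dy|x,u)|\le\lambda_i(y)\|x'-x\|\mu(dy)$ for $x,x'\in q_i$, $u\in U$, and $|t(dy|x,u')-t(dy|x,u)|\le\beta_i(y)\|u'-u\|\mu(dy)$ for $x\in q_i$, $u,u'\in U$. Put $\Lambda_i=\int\lambda_i\,d\mu$,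 $B_i=\int\beta_i\,d\mu$. Let $L_i\ge0$ be a Lipschitz constant on $q_i$ of all networks $NN_{(q_i,\mathcal P)}$, and let $\mathcal L_X\ge1$ satisfy $\sup_{x\in X}\|x\|\le\mathcal L_X$. **Theorem.** With $$\Delta^{NN}=\max_{1\le i\le N}\left(\Lambda_i\eta_q+B_iL_i\eta_q+\sqrt{m(n+1)}\,\mathcal L_XB_i\eta_{\mathcal P}\right),$$ for every $x\in X_0$ and $s_0\in S_0$, with $s=\delta(s_0,L(x))$ the automaton state after reading the label of $x$, $$\left|\Pr\left(\xi^{(x,s)}\models\varphi\right)-\hat V^*_0(\mathrm{abs}(x),s)\right|\le HZ\,\Delta^{NN}.$$ Moreover, for every $x\in X_0$ and every $s\in S$, the probability that the closed loop started in $(x,s)$ has $s^{(k)}\in G$ for some $0\le k\le H$ differs from $\hat V^*_0(\mathrm{abs}(x),s)$ by at most $HZ\,\Delta^{NN}$. -/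

import Mathlib

open MeasureTheory ProbabilityTheory

noncomputable section

namespace NeuroPlan

/-- `ℝⁿ` with the Euclidean norm. -/
abbrev E (n : ℕ) := EuclideanSpace ℝ (Fin n)

/-! ### Affine controllers, ReLU networks and CPWA functions -/

/-- Parameters `K = (K', b') ∈ ℝ^{m × (n+1)}` of an affine controller; the last column is `b'`. -/
abbrev Gain (m n : ℕ) := Matrix (Fin m) (Fin (n + 1)) ℝ

/-- The affine controller `K(x) = K' x + b'`. -/
def affineMap {m n : ℕ} (K : Gain m n) (x : E n) : E m :=
  WithLp.toLp 2 fun a => (∑ j : Fin n, K a j.castSucc * x j) + K a (Fin.last n)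

/-- Feed-forward ReLU networks with `i` inputs and `o` outputs, given by their weights. The output
layer may or may not apply the ReLU; all other layers do. -/
inductive ReLUNet : ℕ → ℕ → Type
  | outLinear {i o : ℕ} (W : Matrix (Fin o) (Fin i) ℝ) (b : Fin o → ℝ) : ReLUNet i o
  | outReLU {i o : ℕ} (W : Matrix (Fin o) (Fin i) ℝ) (b : Fin o → ℝ) : ReLUNet i o
  | layer {i h o : ℕ} (W : Matrix (Fin h) (Fin i) ℝ) (b : Fin h → ℝ) (rest : ReLUNet h o) :
      ReLUNet i o

/-- The function computed by a network, in coordinates. -/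
def ReLUNet.run : {i o : ℕ} → ReLUNet i o → (Fin i → ℝ) → (Fin o → ℝ)
  | _, _, .outLinear W b, z => W.mulVec z + b
  | _, _, .outReLU W b, z => fun k => max ((W.mulVec z + b) k) 0
  | _, _, .layer W b rest, z => rest.run fun k => max ((W.mulVec z + b) k) 0

/-- The function `ℝⁱ → ℝᵒ` computed by a network. -/
def ReLUNet.eval {i o : ℕ} (θ : ReLUNet i o) (x : E i) : E o := WithLp.toLp 2 (θ.run fun j => x j)

lemma ReLUNet.continuous_run : ∀ {i o : ℕ} (θ : ReLUNet i o), Continuous θ.run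
  | _, _, .outLinear W b => by
      simp only [ReLUNet.run]; fun_prop
  | _, _, .outReLU W b => by
      simp only [ReLUNet.run, Matrix.mulVec, dotProduct, Pi.add_apply]; fun_prop
  | _, _, .layer W b rest => by
      have h := rest.continuous_run
      simp only [ReLUNet.run, Matrix.mulVec, dotProduct, Pi.add_apply]
      exact h.comp (by fun_prop)

lemma ReLUNet.continuous_eval {i o : ℕ} (θ : ReLUNet i o) : Continuous θ.eval := by
  have h := θ.continuous_run
  unfold ReLUNet.eval
  exact (PiLp.continuous_toLp 2 _).comp (h.comp (by fun_prop))

/-- Finite intersections of closed half-spaces. -/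
def IsPolyhedron {n : ℕ} (R : Set (E n)) : Prop :=
  ∃ (k : ℕ) (a : Fin k → E n) (c : Fin k → ℝ), R = {x | ∀ i, inner ℝ (a i) x ≤ c i}

/-- `f|_q ∈ 𝒫`: on `X` the function `f` has a piecewise affine form, with finitely many polyhedral
linear regions that cover `X` and have disjoint interiors, such that the affine parameters of every
linear region that meets `q` belong to `𝒫`. -/
def RestrictMem {m n : ℕ} (X q : Set (E n)) (P : Set (Gain m n)) (f : E n → E m) : Prop :=
  ∃ (l : ℕ) (R : Fin l → Set (E n)) (K : Fin l → Gain m n),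
    (∀ i, IsPolyhedron (R i)) ∧
    (⋃ i, R i ∩ X) = X ∧
    (Pairwise fun i j => Disjoint (interior (R i ∩ X)) (interior (R j ∩ X))) ∧
    (∀ i, ∀ x ∈ R i ∩ X, f x = affineMap (K i) x) ∧
    ∀ i, (R i ∩ X ∩ q).Nonempty → K i ∈ P

/-! ### Partitions of the state space and of the controller space -/

/-- A partition of the state space `X ⊆ ℝⁿ` into abstract states `q_1, …, q_N` and of the controller
space `𝒦 ⊆ ℝ^{m × (n+1)}` into controller partitions `𝒫_1, …, 𝒫_M`, with grid sizes `ηq`, `ηP`.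
All pieces are balls of the max norm; since the pieces of a partition share their boundaries,
each is allowed to contain any part of its own boundary. -/
structure Grid {n m : ℕ} (X : Set (E n)) (U : Set (E m)) (𝒦 : Set (Gain m n)) (ηq ηP : ℝ)
    (N M : ℕ) where
  /-- the abstract states, as subsets of `ℝⁿ` -/
  cell : Fin N → Set (E n)
  /-- the centers of the abstract states -/
  ct : Fin N → E n
  /-- the radii of the abstract states -/
  rad : Fin N → ℝ
  rad_pos : ∀ i, 0 < rad i
  ball_subset_cell : ∀ i, {x : E n | ∀ j, |x j - ct i j| < rad i} ⊆ cell i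
  cell_subset_ball : ∀ i, cell i ⊆ {x : E n | ∀ j, |x j - ct i j| ≤ rad i}
  measurable_cell : ∀ i, MeasurableSet (cell i)
  /-- the (Euclidean) diameter of an abstract state is at most `ηq` -/
  diam_cell : ∀ i, Metric.diam (cell i) ≤ ηq
  iUnion_cell : (⋃ i, cell i) = X
  disjoint_cell : Pairwise fun i j => Disjoint (interior (cell i)) (interior (cell j))
  /-- the controller partitions, as sets of parameters -/
  part : Fin M → Set (Gain m n)
  /-- the centers of the controller partitions -/
  ctP : Fin M → Gain m n
  /-- the radii of the controller partitions -/
  radP : Fin M → ℝ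
  radP_pos : ∀ p, 0 < radP p
  ball_subset_part : ∀ p, {K : Gain m n | ∀ a b, |K a b - ctP p a b| < radP p} ⊆ part p
  part_subset_ball : ∀ p, part p ⊆ {K : Gain m n | ∀ a b, |K a b - ctP p a b| ≤ radP p}
  /-- the diameter of a controller partition in the max norm is at most `ηP` -/
  diam_part : ∀ p, 2 * radP p ≤ ηP
  iUnion_part : (⋃ p, part p) = 𝒦
  disjoint_part : Pairwise fun p r => Disjoint (interior (part p)) (interior (part r))
  /-- the map `abs` that sends a state to an abstract state that contains it -/
  abs : X → Fin N
  mem_cell_abs : ∀ x : X, (x : E n) ∈ cell (abs x)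
  measurable_abs : Measurable abs
  /-- the central controllers are admissible at the central states -/
  admissible : ∀ i p, affineMap (ctP p) (ct i) ∈ U

namespace Grid

variable {n m N M : ℕ} {X : Set (E n)} {U : Set (E m)} {𝒦 : Set (Gain m n)} {ηq ηP : ℝ}

lemma cell_subset (g : Grid X U 𝒦 ηq ηP N M) (i : Fin N) : g.cell i ⊆ X :=
  (Set.subset_iUnion g.cell i).trans g.iUnion_cell.subset

lemma ct_mem_cell (g : Grid X U 𝒦 ηq ηP N M) (i : Fin N) : g.ct i ∈ g.cell i :=
  g.ball_subset_cell i (by simpa using fun _ => g.rad_pos i)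

/-- The center `ct(q)` as a state. -/
def ctState (g : Grid X U 𝒦 ηq ηP N M) (i : Fin N) : X := ⟨g.ct i, g.cell_subset i (g.ct_mem_cell i)⟩

/-- The action `κ(z)` of the central controller `κ = ct(𝒫)` at the center `z = ct(q)`. -/
def ctAction (g : Grid X U 𝒦 ηq ηP N M) (i : Fin N) (p : Fin M) : U :=
  ⟨affineMap (g.ctP p) (g.ct i), g.admissible i p⟩

/-- An abstract state as a set of states. -/
def cellSet (g : Grid X U 𝒦 ηq ηP N M) (i : Fin N) : Set X := {x | (x : E n) ∈ g.cell i}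

/-- A library of local networks: for every abstract state `q` and controller partition `𝒫` one ReLU
network that satisfies the constraint of formal training, `NN_(q,𝒫)|_q ∈ 𝒫`, and whose outputs on
`q` are control actions. -/
structure Library (g : Grid X U 𝒦 ηq ηP N M) where
  net : Fin N → Fin M → ReLUNet n m
  formal : ∀ i p, RestrictMem X (g.cell i) (g.part p) (net i p).eval
  mapsTo : ∀ i p, ∀ x ∈ g.cell i, (net i p).eval x ∈ U

/-- A labeling function `L : X → 2^AP` such that each atomic proposition has one truth value on each
abstract state (so that abstract states have labels). -/
structure Labeling (g : Grid X U 𝒦 ηq ηP N M) (AP : Type*) where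
  label : X → Set AP
  label_eq : ∀ x y : X, g.abs x = g.abs y → label x = label y

/-- The label of an abstract state: the propositions that are true at it. -/
def Labeling.abstract {g : Grid X U 𝒦 ηq ηP N M} {AP : Type*} (L : g.Labeling AP) (i : Fin N) :
    Set AP := {σ | ∀ x : X, g.abs x = i → σ ∈ L.label x}

end Grid

/-! ### Specifications and automata -/

/-- BLTL formulas over the atomic propositions `AP`. -/
inductive BLTL (AP : Type*)
  | atom (σ : AP) : BLTL AP
  | neg (φ : BLTL AP) : BLTL AP
  | or (φ ψ : BLTL AP) : BLTL AP
  /-- `φ U_[k₁,k₂] ψ` -/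
  | until (k₁ k₂ : ℕ) (φ ψ : BLTL AP) : BLTL AP

/-- `φ` holds at position `i` of the word `w`. -/
def BLTL.Holds {AP : Type*} (w : ℕ → Set AP) : BLTL AP → ℕ → Prop
  | .atom σ, i => σ ∈ w i
  | .neg φ, i => ¬ φ.Holds w i
  | .or φ ψ, i => φ.Holds w i ∨ ψ.Holds w i
  | .until k₁ k₂ φ ψ, i =>
      ∃ k, k₁ ≤ k ∧ k ≤ k₂ ∧ ψ.Holds w (i + k) ∧ ∀ j < k, φ.Holds w (i + j)

/-- Syntactically co-safe LTL formulas (`◇ ψ` is `true U ψ`). -/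
inductive ScLTL (AP : Type*)
  | tru : ScLTL AP
  | atom (σ : AP) : ScLTL AP
  | negAtom (σ : AP) : ScLTL AP
  | and (φ ψ : ScLTL AP) : ScLTL AP
  | or (φ ψ : ScLTL AP) : ScLTL AP
  | next (φ : ScLTL AP) : ScLTL AP
  | until (φ ψ : ScLTL AP) : ScLTL AP

/-- `φ` holds at position `i` of the word `w`. -/
def ScLTL.Holds {AP : Type*} (w : ℕ → Set AP) : ScLTL AP → ℕ → Prop
  | .tru, _ => True
  | .atom σ, i => σ ∈ w i
  | .negAtom σ, i => σ ∉ w i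
  | .and φ ψ, i => φ.Holds w i ∧ ψ.Holds w i
  | .or φ ψ, i => φ.Holds w i ∨ ψ.Holds w i
  | .next φ, i => φ.Holds w (i + 1)
  | .until φ ψ, i => ∃ k, ψ.Holds w (i + k) ∧ ∀ j < k, φ.Holds w (i + j)

/-- Mission specifications: BLTL or scLTL formulas. -/
inductive Spec (AP : Type*)
  | bltl (φ : BLTL AP) : Spec AP
  | scltl (φ : ScLTL AP) : Spec AP

/-- Satisfaction by infinite words. -/
def Spec.SatInf {AP : Type*} (w : ℕ → Set AP) : Spec AP → Prop
  | .bltl φ => φ.Holds w 0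
  | .scltl φ => φ.Holds w 0

/-- Satisfaction by finite words: `u ⊨ φ` if every infinite word that extends `u` satisfies `φ`
(`u` is a good prefix). For a BLTL formula whose time bounds do not reach beyond the end of `u`,
all extensions agree and this is the usual evaluation of the formula on `u`. -/
def Spec.Sat {AP : Type*} (u : List (Set AP)) (φ : Spec AP) : Prop :=
  ∀ w : ℕ → Set AP, (∀ k (hk : k < u.length), w k = u[k]) → φ.SatInf w

/-- Deterministic automata `(S, S₀, 2^AP, G, δ)`. -/
structure MissionDFA (S AP : Type*) where
  init : Set S
  acc : Set S
  step : S → Set AP → S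

/-- Started in `s`, the automaton reaches the accepting set while it reads the letters of `u`. -/
def MissionDFA.Reaches {S AP : Type*} (A : MissionDFA S AP) (s : S) (u : List (Set AP)) : Prop :=
  ∃ k < u.length, (u.take (k + 1)).foldl A.step s ∈ A.acc

/-- The automaton is equivalent to `φ` for the time horizon `H`: from every initial state it accepts
(by reaching the accepting set) exactly those words of length `H + 1` that satisfy `φ`. -/
def MissionDFA.Equivalent {S AP : Type*} (A : MissionDFA S AP) (φ : Spec AP) (H : ℕ) : Prop :=
  ∀ s₀ ∈ A.init, ∀ u : List (Set AP), u.length = H + 1 → (A.Reaches s₀ u ↔ φ.Sat u)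

namespace Grid

variable {n m N M : ℕ} {X : Set (E n)} {U : Set (E m)} {𝒦 : Set (Gain m n)} {ηq ηP : ℝ}
  {S AP : Type*}

/-! ### The symbolic model, its product with the automaton, and dynamic programming -/

/-- The transition probability `t̂(q' | q, 𝒫) = ∫_{q'} t(dx' | z, κ(z))`. -/
def tHat (g : Grid X U 𝒦 ηq ηP N M) (t : Kernel (X × U) X) (q' q : Fin N) (p : Fin M) : ℝ :=
  (t (g.ctState q, g.ctAction q p)).real (g.cellSet q')

open Classical in
/-- The transition probability `t̂⊗(q', s' | q, s, 𝒫)` of the product MDP. -/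
def tHatProd (g : Grid X U 𝒦 ηq ηP N M) (t : Kernel (X × U) X) (L : g.Labeling AP)
    (A : MissionDFA S AP) (q' : Fin N) (s' : S) (q : Fin N) (s : S) (p : Fin M) : ℝ :=
  if s' = A.step s (L.abstract q') then g.tHat t q' q p else 0

open Classical in
/-- `Q̂(q, s, 𝒫)`, computed from the value function `V` of the next time step. -/
def backup [Fintype S] (g : Grid X U 𝒦 ηq ηP N M) (t : Kernel (X × U) X) (L : g.Labeling AP)
    (A : MissionDFA S AP) (V : Fin N → S → ℝ) (q : Fin N) (s : S) (p : Fin M) : ℝ :=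
  A.acc.indicator 1 s +
    A.accᶜ.indicator 1 s * ∑ q' : Fin N, ∑ s' : S, V q' s' * g.tHatProd t L A q' s' q s p

/-- The optimal value function with `r` steps to go. -/
def valueToGo [Fintype S] (g : Grid X U 𝒦 ηq ηP N M) (t : Kernel (X × U) X) (L : g.Labeling AP)
    (A : MissionDFA S AP) : ℕ → Fin N → S → ℝ
  | 0 => fun _ s => A.acc.indicator 1 s
  | r + 1 => fun q s => ⨆ p : Fin M, g.backup t L A (g.valueToGo t L A r) q s p

/-- The optimal value function `V̂*_k`, `0 ≤ k ≤ H`. -/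
def Vhat [Fintype S] (g : Grid X U 𝒦 ηq ηP N M) (t : Kernel (X × U) X) (L : g.Labeling AP)
    (A : MissionDFA S AP) (H k : ℕ) : Fin N → S → ℝ := g.valueToGo t L A (H - k)

/-- The function `Q̂_k`, `0 ≤ k < H`. -/
def Qhat [Fintype S] (g : Grid X U 𝒦 ηq ηP N M) (t : Kernel (X × U) X) (L : g.Labeling AP)
    (A : MissionDFA S AP) (H k : ℕ) : Fin N → S → Fin M → ℝ :=
  g.backup t L A (g.Vhat t L A H (k + 1))

/-- The activation map is the one chosen by dynamic programming: at each time `k < H` and product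
state `(q, s)` it selects a maximizer `𝒫*` of `Q̂_k(q, s, ·)`, that is, the network `NN_(q,𝒫*)`. -/
def IsDPSelection [Fintype S] (g : Grid X U 𝒦 ηq ηP N M) (t : Kernel (X × U) X)
    (L : g.Labeling AP) (A : MissionDFA S AP) (H : ℕ) (Γ : ℕ → Fin N → S → Fin M) : Prop :=
  ∀ k < H, ∀ q s p, g.Qhat t L A H k q s p ≤ g.Qhat t L A H k q s (Γ k q s)

/-! ### The closed loop -/

/-- The control action of the composed planner at time `k` in robot state `x` and automaton
state `s`: the output of the network `NN_(q,𝒫)` with `q = abs(x)` and `𝒫 = Γ_k(q, s)`. -/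
def Library.action {g : Grid X U 𝒦 ηq ηP N M} (lib : g.Library) (Γ : ℕ → Fin N → S → Fin M)
    (k : ℕ) (y : X × S) : U :=
  ⟨(lib.net (g.abs y.1) (Γ k (g.abs y.1) y.2)).eval y.1, lib.mapsTo _ _ _ (g.mem_cell_abs y.1)⟩

variable [Fintype S] [MeasurableSpace S] [DiscreteMeasurableSpace S]

lemma Library.measurable_action {g : Grid X U 𝒦 ηq ηP N M} (lib : g.Library)
    (Γ : ℕ → Fin N → S → Fin M) (k : ℕ) : Measurable (lib.action Γ k) := by
  refine Measurable.subtype_mk ?_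
  have h : Measurable fun w : X × (Fin N × S) =>
      (lib.net w.2.1 (Γ k w.2.1 w.2.2)).eval (w.1 : E n) :=
    measurable_from_prod_countable_left fun w =>
      (lib.net w.1 (Γ k w.1 w.2)).continuous_eval.measurable.comp measurable_subtype_coe
  exact h.comp (measurable_fst.prodMk ((g.measurable_abs.comp measurable_fst).prodMk measurable_snd))

/-- The update `(s, x') ↦ (x', δ(s, L(x')))` of the product state. -/
def Labeling.update {g : Grid X U 𝒦 ηq ηP N M} (L : g.Labeling AP) (A : MissionDFA S AP)
    (w : S × X) : X × S := (w.2, A.step w.1 (L.label w.2))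

lemma Labeling.measurable_update {g : Grid X U 𝒦 ηq ηP N M} (L : g.Labeling AP)
    (A : MissionDFA S AP) : Measurable (L.update A) := by
  refine measurable_snd.prodMk ?_
  refine measurable_from_prod_countable_right fun s => ?_
  have : (fun x : X => A.step s (L.label x)) =
      (fun i : Fin N => A.step s {σ | ∃ x : X, g.abs x = i ∧ σ ∈ L.label x}) ∘ g.abs := by
    funext x
    have h : L.label x = {σ | ∃ y : X, g.abs y = g.abs x ∧ σ ∈ L.label y} := by
      ext σ
      exact ⟨fun h => ⟨x, rfl, h⟩, fun ⟨y, hy, h⟩ => L.label_eq y x hy ▸ h⟩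
    simp only [Function.comp_apply]
    rw [← h]
  change Measurable fun x : X => A.step s (L.label x)
  rw [this]
  exact (measurable_of_finite _).comp g.measurable_abs

/-- One step of the closed loop from time `k` to time `k + 1`: `x' ∼ t(· | x, u)` with the action
`u` of the planner, and `s' = δ(s, L(x'))`. -/
def Library.closedLoopStep {g : Grid X U 𝒦 ηq ηP N M} (lib : g.Library) (t : Kernel (X × U) X)
    (L : g.Labeling AP) (A : MissionDFA S AP) (Γ : ℕ → Fin N → S → Fin M) (k : ℕ) :
    Kernel (X × S) (X × S) :=
  ((Kernel.deterministic Prod.snd measurable_snd) ×ₖ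
    t.comap (fun y => (y.1, lib.action Γ k y))
      (measurable_fst.prodMk (lib.measurable_action Γ k))).map (L.update A)

/-- The law of the closed-loop trajectory `(x⁽⁰⁾, s⁽⁰⁾), …, (x⁽ᴴ⁾, s⁽ᴴ⁾)` that starts in the
product state `y`. -/
def Library.trajectory {g : Grid X U 𝒦 ηq ηP N M} (lib : g.Library) (t : Kernel (X × U) X)
    (L : g.Labeling AP) (A : MissionDFA S AP) (Γ : ℕ → Fin N → S → Fin M) (H : ℕ) (y : X × S) :
    Measure ((i : Finset.Iic H) → X × S) :=
  Kernel.partialTraj (X := fun _ => X × S)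
    (fun k => (lib.closedLoopStep t L A Γ k).comap (fun h => h ⟨k, Finset.mem_Iic.2 le_rfl⟩)
      (measurable_pi_apply _)) 0 H (fun _ => y)

/-- The word `L(x⁽⁰⁾) … L(x⁽ᴴ⁾)` of a trajectory. -/
def Labeling.word {g : Grid X U 𝒦 ηq ηP N M} (L : g.Labeling AP) {H : ℕ}
    (ξ : (i : Finset.Iic H) → X × S) : List (Set AP) :=
  List.ofFn fun k : Fin (H + 1) => L.label (ξ ⟨k, Finset.mem_Iic.2 (Nat.lt_succ_iff.1 k.2)⟩).1

/-- `Pr(ξ^(y) ⊨ φ)` for the closed-loop trajectory from the product state `y`. -/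
def Library.probSat {g : Grid X U 𝒦 ηq ηP N M} (lib : g.Library) (t : Kernel (X × U) X)
    (L : g.Labeling AP) (A : MissionDFA S AP) (Γ : ℕ → Fin N → S → Fin M) (H : ℕ) (φ : Spec AP)
    (y : X × S) : ℝ :=
  (lib.trajectory t L A Γ H y).real {ξ | φ.Sat (L.word ξ)}

/-- The probability that the closed-loop trajectory from the product state `y` reaches the accepting
set `X × G` within `H` steps. -/
def Library.probReach {g : Grid X U 𝒦 ηq ηP N M} (lib : g.Library) (t : Kernel (X × U) X)
    (L : g.Labeling AP) (A : MissionDFA S AP) (Γ : ℕ → Fin N → S → Fin M) (H : ℕ)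
    (y : X × S) : ℝ :=
  (lib.trajectory t L A Γ H y).real {ξ | ∃ k, (ξ k).2 ∈ A.acc}

/-- `t(· | x, u)` is Lipschitz in `x` on each abstract state `q_i` with Lipschitz constants
`lam i y`, relative to `μ`: the inequality
`|t(dy | x', u) - t(dy | x, u)| ≤ lam i y * ‖x' - x‖ * μ(dy)` of measures, tested on all sets. -/
def LipschitzInState (g : Grid X U 𝒦 ηq ηP N M) (t : Kernel (X × U) X) (μ : Measure X)
    (lam : Fin N → X → ℝ) : Prop :=
  (∀ i y, 0 ≤ lam i y) ∧ (∀ i, Integrable (lam i) μ) ∧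
  ∀ i, ∀ x ∈ g.cellSet i, ∀ x' ∈ g.cellSet i, ∀ (u : U) (B : Set X), MeasurableSet B →
    |(t (x', u)).real B - (t (x, u)).real B| ≤ ∫ y in B, lam i y * ‖(x' : E n) - x‖ ∂μ

/-- `t(· | x, u)` is Lipschitz in `u` for `x` in each abstract state `q_i`, with Lipschitz constants
`bet i y`, relative to `μ`. -/
def LipschitzInAction (g : Grid X U 𝒦 ηq ηP N M) (t : Kernel (X × U) X) (μ : Measure X)
    (bet : Fin N → X → ℝ) : Prop :=
  (∀ i y, 0 ≤ bet i y) ∧ (∀ i, Integrable (bet i) μ) ∧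
  ∀ i, ∀ x ∈ g.cellSet i, ∀ (u u' : U) (B : Set X), MeasurableSet B →
    |(t (x, u')).real B - (t (x, u)).real B| ≤ ∫ y in B, bet i y * ‖(u' : E m) - u‖ ∂μ

/-- `Lip i` is a Lipschitz constant on `q_i` of all local networks at `q_i`. -/
def Library.LipschitzNets {g : Grid X U 𝒦 ηq ηP N M} (lib : g.Library) (Lip : Fin N → ℝ) : Prop :=
  (∀ i, 0 ≤ Lip i) ∧
  ∀ i p, ∀ x ∈ g.cell i, ∀ x' ∈ g.cell i,
    ‖(lib.net i p).eval x - (lib.net i p).eval x'‖ ≤ Lip i * ‖x - x'‖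

/-- `Δ^NN = max_i (Λ_i η_q + B_i L_i η_q + √(m(n+1)) 𝓛_X B_i η_𝒫)`, where `Λ_i = ∫ λ_i dμ` and
`B_i = ∫ β_i dμ`. -/
def deltaNN (_g : Grid X U 𝒦 ηq ηP N M) (μ : Measure X) (lam bet : Fin N → X → ℝ)
    (Lip : Fin N → ℝ) (LX : ℝ) : ℝ :=
  ⨆ i : Fin N, ((∫ y, lam i y ∂μ) * ηq + (∫ y, bet i y ∂μ) * Lip i * ηq +
    √(m * (n + 1)) * LX * (∫ y, bet i y ∂μ) * ηP)

end Grid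

end NeuroPlan

end

/-! The proof compares the closed loop with the symbolic model along one trajectory and telescopes.
Let `pathValue` at time `k` be `1` if the automaton has already accepted, and the optimal symbolic
value of the current pair (cell, automaton state) otherwise. At time `0` this is the symbolic value
of the start; at time `H` it is the indicator of having reached the accepting set. Hence it suffices
that each step changes the expected path value by at most `Δ^NN`
(`abs_integral_pathValue_extend_sub_le`).

Off the accepting set, the optimal value is the expectation of the next value under `t(· | z,
κ(z))`, where `z` is the center of the cell and `κ` the center of the chosen controller partition.
The closed loop takes the expectation of the same `[0,1]`-valued function of the next cell under
`t(· | x, NN(x))`. Moving `x` to `z` costs `Λ_i η_q`; moving `NN(x)` to `κ(z)` costs `B_i ‖NN(x) -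
κ(z)‖`. This norm is split at `NN(z)`: the Lipschitz constant gives `L_i η_q`. At `z` the network
agrees with an affine map whose parameters lie in the partition of `κ`, so `NN(z)` and `κ(z)` differ
by at most `√(m(n+1)) 𝓛_X η_𝒫`.

The automaton is deterministic, so the next automaton state is a function of the next cell and no
sum over `S` is lost: the argument yields `H Δ^NN`, and `Z ≥ 1` gives the stated bound. Satisfaction
reduces to reachability because the automaton component almost surely is the run on the word of
labels. -/

noncomputable section

namespace NeuroPlan

/-! ### Finite-valued integrands and perturbation of affine controllers. -/

/-- The expectation of a function that factors through a finite type. -/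
lemma integral_comp_fintype {α ι : Type*} [MeasurableSpace α] [Fintype ι] [MeasurableSpace ι]
    [MeasurableSingletonClass ι] (ν : Measure α) [IsFiniteMeasure ν] {f : α → ι} (hf : Measurable f)
    (c : ι → ℝ) : ∫ x, c (f x) ∂ν = ∑ i, c i * ν.real (f ⁻¹' {i}) := by
  rw [← integral_map (f := c) hf.aemeasurable (measurable_of_finite c).aestronglyMeasurable,
    integral_fintype (Integrable.of_finite)]
  refine Finset.sum_congr rfl fun i _ => ?_
  rw [map_measureReal_apply hf (measurableSet_singleton i), smul_eq_mul, mul_comm]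

/-- Affine controllers whose parameters differ by at most `r` in the max norm. -/
lemma norm_affineMap_sub_le {m n : ℕ} (K K' : Gain m n) {r LX : ℝ} (hr : 0 ≤ r)
    (hK : ∀ a b, |K a b - K' a b| ≤ r) (x : E n) (hx : ‖x‖ ≤ LX) (hLX : 1 ≤ LX) :
    ‖affineMap K x - affineMap K' x‖ ≤ √(m * (n + 1)) * LX * (2 * r) := by
  have hrow : ∀ a, (affineMap K x - affineMap K' x) a ^ 2 ≤ (n + 1) * (2 * LX * r) ^ 2 := by
    intro a
    -- With `y = (x, 1)` each row is a dot product of length `n + 1`. Cauchy–Schwarz bounds its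
    -- square by `(n + 1) r² (‖x‖² + 1)`, and `LX ≥ 1` absorbs the `1`. The factor `2` is kept
    -- because `2 * r` becomes the diameter of a controller partition.
    set y : Fin (n + 1) → ℝ := Fin.snoc (fun j => x j) 1 with hy
    have e : (affineMap K x - affineMap K' x) a = ∑ b, (K a b - K' a b) * y b := by
      rw [Fin.sum_univ_castSucc]
      simp only [affineMap, PiLp.sub_apply, hy, Fin.snoc_castSucc, Fin.snoc_last, sub_mul,
        Finset.sum_sub_distrib]
      ring
    have hyn : ∑ b, y b ^ 2 = ‖x‖ ^ 2 + 1 := by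
      rw [Fin.sum_univ_castSucc, EuclideanSpace.norm_sq_eq]
      simp [hy]
    rw [e]
    calc (∑ b, (K a b - K' a b) * y b) ^ 2
        ≤ (∑ b, (K a b - K' a b) ^ 2) * ∑ b, y b ^ 2 := Finset.sum_mul_sq_le_sq_mul_sq _ _ _
      _ ≤ (∑ _b : Fin (n + 1), r ^ 2) * (LX ^ 2 + LX ^ 2) := by
          rw [hyn]
          refine mul_le_mul (Finset.sum_le_sum fun b _ =>
            sq_le_sq' (abs_le.1 (hK a b)).1 (abs_le.1 (hK a b)).2) ?_ (by positivity) (by positivity)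
          nlinarith [norm_nonneg x]
      _ ≤ (n + 1) * (2 * LX * r) ^ 2 := by
          simp only [Finset.sum_const, Finset.card_univ, Fintype.card_fin, nsmul_eq_mul]
          push_cast
          have : 0 ≤ ((n : ℝ) + 1) * (LX ^ 2 * r ^ 2) := by positivity
          nlinarith
  rw [EuclideanSpace.norm_eq]
  calc √(∑ a, ‖(affineMap K x - affineMap K' x) a‖ ^ 2)
      ≤ √((m * (n + 1)) * (2 * LX * r) ^ 2) := by
        refine Real.sqrt_le_sqrt ?_
        calc _ ≤ ∑ _a : Fin m, (n + 1) * (2 * LX * r) ^ 2 :=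
              Finset.sum_le_sum fun a _ => by rw [Real.norm_eq_abs, sq_abs]; exact hrow a
          _ = _ := by simp; ring
    _ = √(m * (n + 1)) * LX * (2 * r) := by
        rw [Real.sqrt_mul (by positivity), Real.sqrt_sq (by positivity)]; ring

/-! ### Cells and their fibres under `abs`. -/

namespace Grid

variable {n m N M : ℕ} {X : Set (E n)} {U : Set (E m)} {𝒦 : Set (Gain m n)} {ηq ηP : ℝ}
  {S AP : Type*}

lemma norm_sub_le_of_mem_cell (g : Grid X U 𝒦 ηq ηP N M) {i : Fin N} {x y : E n}
    (hx : x ∈ g.cell i) (hy : y ∈ g.cell i) : ‖x - y‖ ≤ ηq := by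
  -- `Metric.diam` is `0` on unbounded sets, so `diam_cell` controls distances only once the cell is
  -- known to be bounded.
  have hb : Bornology.IsBounded (g.cell i) := by
    refine Bornology.IsBounded.subset
      (t := Metric.closedBall (g.ct i) (√(∑ _j : Fin n, g.rad i ^ 2))) Metric.isBounded_closedBall fun z hz => ?_
    rw [mem_closedBall_iff_norm, EuclideanSpace.norm_eq]
    refine Real.sqrt_le_sqrt (Finset.sum_le_sum fun j _ => ?_)
    have := g.cell_subset_ball i hz j
    rw [PiLp.sub_apply, Real.norm_eq_abs]
    gcongr
  rw [← dist_eq_norm]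
  exact (Metric.dist_le_diam_of_mem hb hx hy).trans (g.diam_cell i)

lemma abs_preimage_subset (g : Grid X U 𝒦 ηq ηP N M) (i : Fin N) :
    g.abs ⁻¹' {i} ⊆ g.cellSet i := by
  rintro x rfl
  exact g.mem_cell_abs x

/-- A point of a cell outside the fibre of `abs` also lies in a second cell, and such overlaps are
null. Overlapping cells can thus be replaced by disjoint fibres. -/
lemma real_cellSet (g : Grid X U 𝒦 ηq ηP N M) (ν : Measure X)
    (hν : ∀ i j, i ≠ j → ν (g.cellSet i ∩ g.cellSet j) = 0) (i : Fin N) :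
    ν.real (g.cellSet i) = ν.real (g.abs ⁻¹' {i}) := by
  refine measureReal_congr (Filter.EventuallyLE.antisymm ?_ (g.abs_preimage_subset i).eventuallyLE)
  have h : ∀ j, j ≠ i → ∀ᵐ x ∂ν, x ∉ g.cellSet i ∩ g.cellSet j := fun j hj =>
    measure_eq_zero_iff_ae_notMem.1 (hν i j hj.symm)
  filter_upwards [ae_all_iff.2 fun j => Filter.eventually_imp_distrib_left.2 (h j)] with x hx hxi
  by_contra hne
  exact hx (g.abs x) hne ⟨hxi, g.mem_cell_abs x⟩

lemma Labeling.abstract_abs {g : Grid X U 𝒦 ηq ηP N M} (L : g.Labeling AP) (x : X) :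
    L.abstract (g.abs x) = L.label x := by
  ext σ
  exact ⟨fun h => h x rfl, fun h y hy => L.label_eq y x hy ▸ h⟩

/-! ### Dynamic programming on the symbolic model. -/

section Backup

variable [Fintype S]

lemma backup_of_mem (g : Grid X U 𝒦 ηq ηP N M) (t : Kernel (X × U) X) (L : g.Labeling AP)
    (A : MissionDFA S AP) (V : Fin N → S → ℝ) (q : Fin N) {s : S} (hs : s ∈ A.acc) (p : Fin M) :
    g.backup t L A V q s p = 1 := by
  simp [backup, hs]

/-- Off the accepting set, `Q̂` is the expectation of the value of the next state under the central
controller at the central state. -/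
lemma backup_of_notMem (g : Grid X U 𝒦 ηq ηP N M) (t : Kernel (X × U) X) [IsMarkovKernel t]
    (ht : ∀ y : X × U, ∀ i j, i ≠ j → t y (g.cellSet i ∩ g.cellSet j) = 0) (L : g.Labeling AP)
    (A : MissionDFA S AP) (V : Fin N → S → ℝ) (q : Fin N) {s : S} (hs : s ∉ A.acc) (p : Fin M) :
    g.backup t L A V q s p =
      ∫ x, V (g.abs x) (A.step s (L.label x)) ∂t (g.ctState q, g.ctAction q p) := by
  classical
  simp_rw [← L.abstract_abs]
  rw [integral_comp_fintype _ g.measurable_abs fun i => V i (A.step s (L.abstract i))]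
  -- Determinism of the automaton leaves a single term of the sum over `s'`.
  simp [backup, hs, tHatProd, tHat, g.real_cellSet _ (ht _)]

lemma valueToGo_mem_Icc (g : Grid X U 𝒦 ηq ηP N M) (t : Kernel (X × U) X) [IsMarkovKernel t]
    (ht : ∀ y : X × U, ∀ i j, i ≠ j → t y (g.cellSet i ∩ g.cellSet j) = 0) (L : g.Labeling AP)
    (A : MissionDFA S AP) (r : ℕ) (q : Fin N) (s : S) :
    g.valueToGo t L A r q s ∈ Set.Icc (0 : ℝ) 1 := by
  induction r generalizing q s with
  | zero =>
    by_cases hs : s ∈ A.acc <;> simp [valueToGo, hs]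
  | succ r ih =>
    have h : ∀ p, g.backup t L A (g.valueToGo t L A r) q s p ∈ Set.Icc (0 : ℝ) 1 := by
      intro p
      by_cases hs : s ∈ A.acc
      · simp [g.backup_of_mem t L A _ q hs p]
      · rw [g.backup_of_notMem t ht L A _ q hs p]
        refine ⟨integral_nonneg fun x => (ih _ _).1, ?_⟩
        refine (integral_mono_of_nonneg (.of_forall fun x => (ih _ _).1) (integrable_const 1)
          (.of_forall fun x => (ih _ _).2)).trans ?_
        simp
    -- The case `M = 0` is covered: an empty real supremum is `0`.
    exact ⟨Real.iSup_nonneg fun p => (h p).1, Real.iSup_le (fun p => (h p).2) zero_le_one⟩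

/-- Lets the two branches of `pathValue` agree when the current state is accepting. `M` must be
positive, since an empty supremum would be `0`. -/
lemma valueToGo_of_mem [Nonempty (Fin M)] (g : Grid X U 𝒦 ηq ηP N M) (t : Kernel (X × U) X)
    (L : g.Labeling AP) (A : MissionDFA S AP) (r : ℕ) (q : Fin N) {s : S} (hs : s ∈ A.acc) :
    g.valueToGo t L A r q s = 1 := by
  cases r with
  | zero => simp [valueToGo, hs]
  | succ r => simp [valueToGo, g.backup_of_mem t L A _ q hs]

lemma IsDPSelection.valueToGo_eq {g : Grid X U 𝒦 ηq ηP N M} {t : Kernel (X × U) X}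
    {L : g.Labeling AP} {A : MissionDFA S AP} {H : ℕ} {Γ : ℕ → Fin N → S → Fin M}
    (hΓ : g.IsDPSelection t L A H Γ) {k : ℕ} (hk : k < H) (q : Fin N) (s : S) :
    g.Vhat t L A H k q s = g.backup t L A (g.Vhat t L A H (k + 1)) q s (Γ k q s) := by
  have e : H - k = H - (k + 1) + 1 := by omega
  have : Nonempty (Fin M) := ⟨Γ k q s⟩
  rw [Vhat, e, valueToGo]
  exact le_antisymm (ciSup_le fun p => hΓ k hk q s p)
    (le_ciSup (f := fun p => g.backup t L A (g.valueToGo t L A (H - (k + 1))) q s p)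
      (Set.finite_range _).bddAbove _)

end Backup

/-! ### One-step comparison of the two transition laws. -/

/-- On a cell, the output of a local network is close to the action of the central controller. -/
lemma Library.norm_eval_sub_ctAction_le {g : Grid X U 𝒦 ηq ηP N M} (lib : g.Library)
    {Lip : Fin N → ℝ} (hLip : lib.LipschitzNets Lip) {LX : ℝ} (hLX : ∀ x ∈ X, ‖x‖ ≤ LX)
    (hLX1 : 1 ≤ LX) (i : Fin N) (p : Fin M) {x : E n} (hx : x ∈ g.cell i) :
    ‖(lib.net i p).eval x - g.ctAction i p‖ ≤ Lip i * ηq + √(m * (n + 1)) * LX * ηP := by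
  have hz := g.ct_mem_cell i
  have hzX := g.cell_subset i hz
  obtain ⟨l, R, K, -, hcov, -, haff, hmem⟩ := lib.formal i p
  obtain ⟨j, hj⟩ := Set.mem_iUnion.1 (hcov.symm ▸ hzX : g.ct i ∈ ⋃ j, R j ∩ X)
  -- The linear region containing the center of the cell meets the cell, so its parameters lie in
  -- the partition; no other region matters.
  have hK := g.part_subset_ball p (hmem j ⟨g.ct i, hj, hz⟩)
  have h1 : ‖(lib.net i p).eval x - (lib.net i p).eval (g.ct i)‖ ≤ Lip i * ηq :=
    (hLip.2 i p x hx _ hz).trans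
      (mul_le_mul_of_nonneg_left (g.norm_sub_le_of_mem_cell hx hz) (hLip.1 i))
  have h2 : ‖(lib.net i p).eval (g.ct i) - g.ctAction i p‖ ≤ √(m * (n + 1)) * LX * ηP := by
    rw [haff j _ hj]
    refine (norm_affineMap_sub_le (K j) (g.ctP p) (g.radP_pos p).le hK (g.ct i) (hLX _ hzX)
      hLX1).trans ?_
    gcongr
    exact g.diam_part p
  exact (norm_sub_le_norm_sub_add_norm_sub _ ((lib.net i p).eval (g.ct i)) _).trans
    (add_le_add h1 h2)

/-- Expectations of a `[0,1]`-valued function of the cell differ by the total mass of a density that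
dominates the difference of the measures. -/
lemma abs_integral_abs_sub_le (g : Grid X U 𝒦 ηq ηP N M) (ν ν' : Measure X)
    [IsFiniteMeasure ν] [IsFiniteMeasure ν'] {μ : Measure X} {f : X → ℝ} (hf : Integrable f μ)
    (h : ∀ B, MeasurableSet B → |ν'.real B - ν.real B| ≤ ∫ y in B, f y ∂μ) {c : Fin N → ℝ}
    (hc : ∀ i, c i ∈ Set.Icc (0 : ℝ) 1) :
    |∫ x, c (g.abs x) ∂ν' - ∫ x, c (g.abs x) ∂ν| ≤ ∫ y, f y ∂μ := by
  have hm : ∀ i, MeasurableSet (g.abs ⁻¹' {i}) := fun i =>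
    g.measurable_abs (measurableSet_singleton i)
  rw [integral_comp_fintype _ g.measurable_abs, integral_comp_fintype _ g.measurable_abs,
    ← Finset.sum_sub_distrib]
  calc |∑ i, (c i * ν'.real (g.abs ⁻¹' {i}) - c i * ν.real (g.abs ⁻¹' {i}))|
      ≤ ∑ i, ∫ y in g.abs ⁻¹' {i}, f y ∂μ := by
        refine (Finset.abs_sum_le_sum_abs _ _).trans (Finset.sum_le_sum fun i _ => ?_)
        -- Weights in `[0,1]` can be dropped fibre by fibre; the fibres are disjoint and cover `X`,
        -- so the bounds add up to the full integral.
        rw [← mul_sub, abs_mul, abs_of_nonneg (hc i).1]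
        exact (mul_le_of_le_one_left (abs_nonneg _) (hc i).2).trans (h _ (hm i))
    _ = ∫ y in ⋃ i, g.abs ⁻¹' {i}, f y ∂μ := by
        rw [integral_iUnion_fintype hm _ fun i => hf.integrableOn]
        intro i j hij
        exact Disjoint.preimage _ (by simpa using hij)
    _ = ∫ y, f y ∂μ := by
        rw [← Set.preimage_iUnion, Set.iUnion_of_singleton, Set.preimage_univ, setIntegral_univ]

section Step

variable [Fintype S] {g : Grid X U 𝒦 ηq ηP N M} {lib : g.Library} {L : g.Labeling AP}
  {t : Kernel (X × U) X} {μ : Measure X} {lam bet : Fin N → X → ℝ} {Lip : Fin N → ℝ} {LX : ℝ}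

lemma term_le_deltaNN (g : Grid X U 𝒦 ηq ηP N M) (μ : Measure X) (lam bet : Fin N → X → ℝ)
    (Lip : Fin N → ℝ) (LX : ℝ) (i : Fin N) :
    (∫ y, lam i y ∂μ) * ηq + (∫ y, bet i y ∂μ) * Lip i * ηq +
      √(m * (n + 1)) * LX * (∫ y, bet i y ∂μ) * ηP ≤ g.deltaNN μ lam bet Lip LX :=
  le_ciSup (f := fun i => (∫ y, lam i y ∂μ) * ηq + (∫ y, bet i y ∂μ) * Lip i * ηq +
      √(m * (n + 1)) * LX * (∫ y, bet i y ∂μ) * ηP) (Set.finite_range _).bddAbove i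

/-- Replacing a state and the output of a local network by the central state and the action of the
central controller changes the expectation of a function of the next cell by at most `Δ^NN`. -/
lemma Library.abs_integral_sub_le (hlam : g.LipschitzInState t μ lam) [IsMarkovKernel t]
    (hbet : g.LipschitzInAction t μ bet) (hLip : lib.LipschitzNets Lip)
    (hLX : ∀ x ∈ X, ‖x‖ ≤ LX) (hLX1 : 1 ≤ LX) (x : X) (u : U) (p : Fin M)
    (hu : (u : E m) = (lib.net (g.abs x) p).eval x) {c : Fin N → ℝ}
    (hc : ∀ i, c i ∈ Set.Icc (0 : ℝ) 1) :
    |∫ x', c (g.abs x') ∂t (x, u) -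
      ∫ x', c (g.abs x') ∂t (g.ctState (g.abs x), g.ctAction (g.abs x) p)| ≤
      g.deltaNN μ lam bet Lip LX := by
  set i := g.abs x with hi
  have hx : x ∈ g.cellSet i := g.mem_cell_abs x
  have hz : g.ctState i ∈ g.cellSet i := g.ct_mem_cell i
  have h1 := g.abs_integral_abs_sub_le _ _ ((hlam.2.1 i).mul_const _)
    (hlam.2.2 i _ hz x hx u) hc
  have h2 := g.abs_integral_abs_sub_le _ _ ((hbet.2.1 i).mul_const _)
    (hbet.2.2 i _ hz (g.ctAction i p) u) hc
  rw [integral_mul_const] at h1 h2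
  have n1 : ‖(x : E n) - g.ctState i‖ ≤ ηq := g.norm_sub_le_of_mem_cell hx hz
  have n2 : ‖(u : E m) - g.ctAction i p‖ ≤ Lip i * ηq + √(m * (n + 1)) * LX * ηP := by
    rw [hu]
    exact lib.norm_eval_sub_ctAction_le hLip hLX hLX1 i p hx
  have p1 : 0 ≤ ∫ y, lam i y ∂μ := integral_nonneg (hlam.1 i)
  have p2 : 0 ≤ ∫ y, bet i y ∂μ := integral_nonneg (hbet.1 i)
  have b1 := mul_le_mul_of_nonneg_left n1 p1
  have b2 := mul_le_mul_of_nonneg_left n2 p2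
  -- The intermediate law is `t(· | z, u)`: first the state moves with the action fixed, then the
  -- action moves at the center.
  refine (abs_sub_le _ (∫ x', c (g.abs x') ∂t (g.ctState i, u)) _).trans ?_
  refine le_trans ?_ (g.term_le_deltaNN μ lam bet Lip LX i)
  linarith

end Step

end Grid

end NeuroPlan

end

noncomputable section

namespace NeuroPlan

/-! ### Trajectory laws built one step at a time. -/

section Trajectory

variable {α : Type*}

/-- Prolongation of a finite trajectory by one point. -/
def extend (k : ℕ) (p : ((i : Finset.Iic k) → α) × α) : (i : Finset.Iic (k + 1)) → α :=
  IicProdIoc (X := fun _ => α) k (k + 1) (p.1, fun _ => p.2)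

lemma extend_of_le {k j : ℕ} (p : ((i : Finset.Iic k) → α) × α) (hj : j ≤ k) :
    extend k p ⟨j, Finset.mem_Iic.2 (hj.trans k.le_succ)⟩ = p.1 ⟨j, Finset.mem_Iic.2 hj⟩ := by
  simp [extend, IicProdIoc, hj]

lemma extend_last {k : ℕ} (p : ((i : Finset.Iic k) → α) × α) :
    extend k p ⟨k + 1, Finset.mem_Iic.2 le_rfl⟩ = p.2 := by
  simp [extend, IicProdIoc]

variable [MeasurableSpace α]

lemma measurable_extend (k : ℕ) : Measurable (extend (α := α) k) :=
  measurable_IicProdIoc.comp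
    (measurable_fst.prodMk (measurable_pi_lambda _ fun _ => measurable_snd))

/-- Exhibits the law at time `k + 1` as a composition-product, so that expectations become iterated
integrals. Both sides are tested on nonnegative measurable functions. -/
lemma partialTraj_succ_eq_map_extend
    (κ : (k : ℕ) → Kernel ((i : Finset.Iic k) → α) α) [∀ k, IsMarkovKernel (κ k)] (k : ℕ)
    (h₀ : (i : Finset.Iic 0) → α) :
    Kernel.partialTraj (X := fun _ => α) κ 0 (k + 1) h₀ =
      (Kernel.partialTraj (X := fun _ => α) κ 0 k h₀ ⊗ₘ κ k).map (extend k) := by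
  have := Kernel.IsMarkovKernel.map (κ k)
    (MeasurableEquiv.piSingleton (X := fun _ => α) k).measurable
  have hm : Measurable (IicProdIoc (X := fun _ => α) k (k + 1)) := measurable_IicProdIoc
  rw [Kernel.partialTraj_succ_of_le k.zero_le]
  refine Measure.ext_of_lintegral _ fun f hf => ?_
  have hf' := hf.comp (measurable_extend (α := α) k)
  rw [lintegral_map hf (measurable_extend k)]
  refine (Kernel.lintegral_map _ hm _ hf).trans ?_
  refine (Kernel.lintegral_comp _ _ _ (hf.comp hm)).trans ?_
  refine Eq.trans ?_ (Measure.lintegral_compProd hf').symm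
  refine lintegral_congr fun h => ?_
  rw [Kernel.lintegral_id_prod (hf.comp hm)]
  refine (Kernel.lintegral_map (κ k)
    (MeasurableEquiv.piSingleton (X := fun _ => α) k).measurable h
    (hf.comp (hm.comp (measurable_prodMk_left (x := h))))).trans (lintegral_congr fun b => ?_)
  have e : MeasurableEquiv.piSingleton (X := fun _ => α) k b = fun _ => b := by
    ext i
    simp [MeasurableEquiv.piSingleton]
  simp only [Function.comp_apply, e]
  rfl

end Trajectory

/-! ### Path values and the law of the closed loop. -/

namespace Grid

variable {n m N M : ℕ} {X : Set (E n)} {U : Set (E m)} {𝒦 : Set (Gain m n)} {ηq ηP : ℝ}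
  {S AP : Type*} [Fintype S] {g : Grid X U 𝒦 ηq ηP N M}

open Classical in
/-- The value of a trajectory up to time `k`: `1` if the accepting set has been reached, and the
optimal value of the current state in the symbolic model otherwise. -/
def pathValue (g : Grid X U 𝒦 ηq ηP N M) (t : Kernel (X × U) X) (L : g.Labeling AP)
    (A : MissionDFA S AP) (H k : ℕ) (ξ : (i : Finset.Iic k) → X × S) : ℝ :=
  if ∃ i, (ξ i).2 ∈ A.acc then 1 else
    g.Vhat t L A H k (g.abs (ξ ⟨k, Finset.mem_Iic.2 le_rfl⟩).1) (ξ ⟨k, Finset.mem_Iic.2 le_rfl⟩).2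

lemma pathValue_mem_Icc {t : Kernel (X × U) X} [IsMarkovKernel t] {L : g.Labeling AP}
    {A : MissionDFA S AP}
    (ht : ∀ y : X × U, ∀ i j, i ≠ j → t y (g.cellSet i ∩ g.cellSet j) = 0)
    (H k : ℕ) (ξ : (i : Finset.Iic k) → X × S) : g.pathValue t L A H k ξ ∈ Set.Icc (0 : ℝ) 1 := by
  unfold pathValue
  split_ifs
  · simp
  · exact g.valueToGo_mem_Icc t ht L A _ _ _

variable [MeasurableSpace S] [DiscreteMeasurableSpace S]

instance (lib : g.Library) (t : Kernel (X × U) X) [IsMarkovKernel t] (L : g.Labeling AP)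
    (A : MissionDFA S AP) (Γ : ℕ → Fin N → S → Fin M) (k : ℕ) :
    IsMarkovKernel (lib.closedLoopStep t L A Γ k) :=
  Kernel.IsMarkovKernel.map _ (L.measurable_update A)

/-- The transition kernels of the closed loop as functions of the past trajectory. -/
def Library.historyStep (lib : g.Library) (t : Kernel (X × U) X)
    (L : g.Labeling AP) (A : MissionDFA S AP) (Γ : ℕ → Fin N → S → Fin M) (k : ℕ) :
    Kernel ((i : Finset.Iic k) → X × S) (X × S) :=
  (lib.closedLoopStep t L A Γ k).comap (fun h => h ⟨k, Finset.mem_Iic.2 le_rfl⟩)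
      (measurable_pi_apply _)

instance (lib : g.Library) (t : Kernel (X × U) X) [IsMarkovKernel t] (L : g.Labeling AP)
    (A : MissionDFA S AP) (Γ : ℕ → Fin N → S → Fin M) (k : ℕ) :
    IsMarkovKernel (lib.historyStep t L A Γ k) :=
  inferInstanceAs (IsMarkovKernel ((lib.closedLoopStep t L A Γ k).comap _ _))

lemma Library.trajectory_zero (lib : g.Library) (t : Kernel (X × U) X) (L : g.Labeling AP)
    (A : MissionDFA S AP) (Γ : ℕ → Fin N → S → Fin M) (y : X × S) :
    lib.trajectory t L A Γ 0 y = Measure.dirac fun _ => y := by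
  rw [trajectory, Kernel.partialTraj_self, Kernel.id_apply]

lemma Library.trajectory_succ (lib : g.Library) (t : Kernel (X × U) X) [IsMarkovKernel t]
    (L : g.Labeling AP) (A : MissionDFA S AP) (Γ : ℕ → Fin N → S → Fin M) (k : ℕ) (y : X × S) :
    lib.trajectory t L A Γ (k + 1) y =
      (lib.trajectory t L A Γ k y ⊗ₘ lib.historyStep t L A Γ k).map (extend k) :=
  partialTraj_succ_eq_map_extend (lib.historyStep t L A Γ) k _

instance (lib : g.Library) (t : Kernel (X × U) X) [IsMarkovKernel t] (L : g.Labeling AP)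
    (A : MissionDFA S AP) (Γ : ℕ → Fin N → S → Fin M) (k : ℕ) (y : X × S) :
    IsProbabilityMeasure (lib.trajectory t L A Γ k y) := by
  change IsProbabilityMeasure
    (Kernel.partialTraj (X := fun _ => X × S) (lib.historyStep t L A Γ) 0 k _)
  infer_instance

lemma Library.closedLoopStep_apply (lib : g.Library) (t : Kernel (X × U) X) [IsMarkovKernel t]
    (L : g.Labeling AP) (A : MissionDFA S AP) (Γ : ℕ → Fin N → S → Fin M) (k : ℕ) (y : X × S) :
    lib.closedLoopStep t L A Γ k y =
      (t (y.1, lib.action Γ k y)).map fun x => (x, A.step y.2 (L.label x)) := by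
  rw [closedLoopStep, Kernel.map_apply _ (L.measurable_update A), Kernel.prod_apply,
    Kernel.deterministic_apply, Kernel.comap_apply, Measure.dirac_prod,
    Measure.map_map (L.measurable_update A) measurable_prodMk_left]
  rfl

lemma Labeling.measurable_step (L : g.Labeling AP) (A : MissionDFA S AP) (s : S) :
    Measurable fun x : X => (x, A.step s (L.label x)) :=
  (L.measurable_update A).comp (measurable_prodMk_left (x := s))

/-- Along almost every trajectory of the closed loop, the automaton reads the labels. -/
lemma Library.ae_trajectory (lib : g.Library) (t : Kernel (X × U) X) [IsMarkovKernel t]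
    (L : g.Labeling AP) (A : MissionDFA S AP) (Γ : ℕ → Fin N → S → Fin M) (y : X × S) (k : ℕ) :
    ∀ᵐ ξ ∂lib.trajectory t L A Γ k y, ξ ⟨0, Finset.mem_Iic.2 k.zero_le⟩ = y ∧
      ∀ j (hj : j < k), (ξ ⟨j + 1, Finset.mem_Iic.2 hj⟩).2 =
        A.step (ξ ⟨j, Finset.mem_Iic.2 hj.le⟩).2 (L.label (ξ ⟨j + 1, Finset.mem_Iic.2 hj⟩).1) := by
  have hp : ∀ {k : ℕ} (i : Finset.Iic k),
      Measurable fun ξ : (i : Finset.Iic k) → X × S => ξ i := fun i => measurable_pi_apply i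
  have hmeas : ∀ {k : ℕ} (i j : Finset.Iic k), MeasurableSet {ξ : (i : Finset.Iic k) → X × S |
      (ξ i).2 = A.step (ξ j).2 (L.label (ξ i).1)} := fun i j =>
    measurableSet_eq_fun (hp i).snd
      ((L.measurable_update A).comp ((hp j).snd.prodMk (hp i).fst)).snd
  have hset : ∀ k, MeasurableSet {ξ : (i : Finset.Iic k) → X × S |
      ξ ⟨0, Finset.mem_Iic.2 k.zero_le⟩ = y ∧
      ∀ j (hj : j < k), (ξ ⟨j + 1, Finset.mem_Iic.2 hj⟩).2 =
        A.step (ξ ⟨j, Finset.mem_Iic.2 hj.le⟩).2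
          (L.label (ξ ⟨j + 1, Finset.mem_Iic.2 hj⟩).1)} := by
    intro k
    simp only [Set.ofPred_and, Set.ofPred_forall]
    exact (hp _ (measurableSet_singleton y)).inter
      (.iInter fun j => .iInter fun hj => hmeas _ _)
  induction k with
  | zero =>
    rw [lib.trajectory_zero, ae_dirac_iff (hset 0)]
    simp
  | succ k ih =>
    rw [lib.trajectory_succ, ae_map_iff (measurable_extend k).aemeasurable (hset _)]
    refine Measure.ae_compProd_of_ae_ae (measurable_extend k (hset _)) ?_
    filter_upwards [ih] with h hh
    rw [historyStep, Kernel.comap_apply, lib.closedLoopStep_apply]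
    refine (ae_map_iff (L.measurable_step A _).aemeasurable
      (((measurable_extend k).comp (measurable_prodMk_left (x := h))) (hset (k + 1)))).2 ?_
    -- For a good past, every new point works: it has the form `(x, A.step s (L.label x))` with `s`
    -- the last automaton state.
    refine .of_forall fun x => ⟨?_, fun j hj => ?_⟩ <;> simp only [Function.comp_apply]
    · exact (extend_of_le _ k.zero_le).trans hh.1
    · rw [extend_of_le _ (Nat.lt_succ_iff.1 hj)]
      rcases (Nat.lt_succ_iff.1 hj).eq_or_lt with rfl | hlt
      · rw [extend_last]
      · rw [extend_of_le _ hlt]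
        exact hh.2 j hlt

lemma measurableSet_reach {Q : Type*} [MeasurableSpace Q] [DiscreteMeasurableSpace Q]
    (A : MissionDFA Q AP) (k : ℕ) : MeasurableSet {ξ : (i : Finset.Iic k) → X × Q |
      ∃ i, (ξ i).2 ∈ A.acc} := by
  simp only [Set.ofPred_exists]
  exact .iUnion fun i => (measurable_pi_apply i).snd (MeasurableSet.of_discrete (s := A.acc))

lemma measurable_pathValue (g : Grid X U 𝒦 ηq ηP N M) (t : Kernel (X × U) X) (L : g.Labeling AP)
    (A : MissionDFA S AP) (H k : ℕ) : Measurable (g.pathValue t L A H k) := by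
  refine Measurable.ite (measurableSet_reach A k) measurable_const ?_
  have h : Measurable fun w : Fin N × S => g.Vhat t L A H k w.1 w.2 := measurable_of_finite _
  exact h.comp ((g.measurable_abs.comp (measurable_pi_apply _).fst).prodMk
    (measurable_pi_apply _).snd)

/-! ### Telescoping the path value. -/

variable {t : Kernel (X × U) X} {L : g.Labeling AP} {A : MissionDFA S AP}
  {lib : g.Library} {H : ℕ} {Γ : ℕ → Fin N → S → Fin M}
  {μ : Measure X} {lam bet : Fin N → X → ℝ} {Lip : Fin N → ℝ} {LX : ℝ}

/-- Needed for steps after acceptance, where the path value does not change, and for inserting the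
factor `Z`. -/
lemma deltaNN_nonneg (hηq : 0 < ηq) (hηP : 0 < ηP) (hlam : g.LipschitzInState t μ lam)
    (hbet : g.LipschitzInAction t μ bet) (hLip : lib.LipschitzNets Lip) (hLX1 : 1 ≤ LX) :
    0 ≤ g.deltaNN μ lam bet Lip LX := by
  refine Real.iSup_nonneg fun i => ?_
  have p1 : 0 ≤ ∫ y, lam i y ∂μ := integral_nonneg (hlam.1 i)
  have p2 : 0 ≤ ∫ y, bet i y ∂μ := integral_nonneg (hbet.1 i)
  have p3 := hLip.1 i
  positivity

variable [IsMarkovKernel t]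

lemma integrable_pathValue
    (ht : ∀ y : X × U, ∀ i j, i ≠ j → t y (g.cellSet i ∩ g.cellSet j) = 0)
    (H k : ℕ) {β : Type*} [MeasurableSpace β] (ν : Measure β) [IsFiniteMeasure ν]
    {f : β → (i : Finset.Iic k) → X × S} (hf : Measurable f) :
    Integrable (fun b => g.pathValue t L A H k (f b)) ν :=
  .of_mem_Icc 0 1 ((g.measurable_pathValue t L A H k).comp hf).aemeasurable
    (.of_forall fun _ => pathValue_mem_Icc ht H k _)

/-- One step of the closed loop changes the expected path value by at most `Δ^NN`. -/
lemma abs_integral_pathValue_extend_sub_le (hηq : 0 < ηq) (hηP : 0 < ηP)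
    (ht : ∀ y : X × U, ∀ i j, i ≠ j → t y (g.cellSet i ∩ g.cellSet j) = 0)
    (hΓ : g.IsDPSelection t L A H Γ) (hlam : g.LipschitzInState t μ lam)
    (hbet : g.LipschitzInAction t μ bet) (hLip : lib.LipschitzNets Lip)
    (hLX : ∀ x ∈ X, ‖x‖ ≤ LX) (hLX1 : 1 ≤ LX) {k : ℕ} (hk : k < H)
    (h : (i : Finset.Iic k) → X × S) :
    |∫ z, g.pathValue t L A H (k + 1) (extend k (h, z)) ∂lib.historyStep t L A Γ k h -
      g.pathValue t L A H k h| ≤ g.deltaNN μ lam bet Lip LX := by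
  by_cases hacc : ∃ i, (h i).2 ∈ A.acc
  · have e : ∀ z, g.pathValue t L A H (k + 1) (extend k (h, z)) = 1 := by
      intro z
      obtain ⟨⟨i, hi⟩, hia⟩ := hacc
      refine if_pos ⟨⟨i, Finset.mem_Iic.2 ((Finset.mem_Iic.1 hi).trans k.le_succ)⟩, ?_⟩
      rw [extend_of_le _ (Finset.mem_Iic.1 hi)]
      exact hia
    have e' : g.pathValue t L A H k h = 1 := if_pos hacc
    simpa [e, e'] using deltaNN_nonneg hηq hηP hlam hbet hLip hLX1
  · set y := h ⟨k, Finset.mem_Iic.2 le_rfl⟩ with hy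
    have : Nonempty (Fin M) := ⟨Γ k (g.abs y.1) y.2⟩
    have hys : y.2 ∉ A.acc := fun hm => hacc ⟨_, hm⟩
    -- If the new state is accepting, its symbolic value is `1` as well, so the case distinction in
    -- `pathValue` disappears.
    have e : ∀ z, g.pathValue t L A H (k + 1) (extend k (h, z)) =
        g.Vhat t L A H (k + 1) (g.abs z.1) z.2 := by
      intro z
      unfold pathValue
      rw [extend_last]
      split_ifs with hz
      · obtain ⟨⟨i, hi⟩, hia⟩ := hz
        rcases (Finset.mem_Iic.1 hi).eq_or_lt with rfl | hlt
        · rw [extend_last] at hia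
          exact (g.valueToGo_of_mem t L A _ _ hia).symm
        · rw [extend_of_le _ (Nat.lt_succ_iff.1 hlt)] at hia
          exact absurd ⟨_, hia⟩ hacc
      · rfl
    have hV : Measurable fun w : X × S => g.Vhat t L A H (k + 1) (g.abs w.1) w.2 :=
      (measurable_of_finite fun w : Fin N × S => g.Vhat t L A H (k + 1) w.1 w.2).comp
        ((g.measurable_abs.comp measurable_fst).prodMk measurable_snd)
    simp_rw [e]
    rw [pathValue, if_neg hacc, hΓ.valueToGo_eq hk, g.backup_of_notMem t ht L A _ _ hys,
      Library.historyStep, Kernel.comap_apply, lib.closedLoopStep_apply,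
      integral_map (L.measurable_step A _).aemeasurable hV.aestronglyMeasurable]
    -- Both integrands become the same function of the next cell.
    simp_rw [← L.abstract_abs]
    exact Library.abs_integral_sub_le hlam hbet hLip hLX hLX1 y.1 (lib.action Γ k y)
      (Γ k (g.abs y.1) y.2) rfl
      (c := fun i => g.Vhat t L A H (k + 1) i (A.step y.2 (L.abstract i)))
      fun i => g.valueToGo_mem_Icc t ht L A _ _ _

/-- Each step adds at most one `Δ^NN`, because the one-step bound is uniform in the past and the law
of the past is a probability measure. -/
lemma abs_integral_pathValue_sub_le (hηq : 0 < ηq) (hηP : 0 < ηP)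
    (ht : ∀ y : X × U, ∀ i j, i ≠ j → t y (g.cellSet i ∩ g.cellSet j) = 0)
    (hΓ : g.IsDPSelection t L A H Γ) (hlam : g.LipschitzInState t μ lam)
    (hbet : g.LipschitzInAction t μ bet) (hLip : lib.LipschitzNets Lip)
    (hLX : ∀ x ∈ X, ‖x‖ ≤ LX) (hLX1 : 1 ≤ LX) (y : X × S)
    {k : ℕ} (hk : k ≤ H) :
    |∫ ξ, g.pathValue t L A H k ξ ∂lib.trajectory t L A Γ k y -
      g.Vhat t L A H 0 (g.abs y.1) y.2| ≤ k * g.deltaNN μ lam bet Lip LX := by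
  induction k with
  | zero =>
    have : g.pathValue t L A H 0 (fun _ => y) = g.Vhat t L A H 0 (g.abs y.1) y.2 := by
      have : Nonempty (Fin M) := ⟨Γ 0 (g.abs y.1) y.2⟩
      unfold pathValue
      split_ifs with hy
      · exact (g.valueToGo_of_mem t L A _ _ hy.choose_spec).symm
      · rfl
    rw [lib.trajectory_zero, integral_dirac' _ _
      (g.measurable_pathValue t L A H 0).stronglyMeasurable, this]
    simp
  | succ k ih =>
    have ih := ih (by omega)
    have hstep : |∫ ξ, g.pathValue t L A H (k + 1) ξ ∂lib.trajectory t L A Γ (k + 1) y -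
        ∫ ξ, g.pathValue t L A H k ξ ∂lib.trajectory t L A Γ k y| ≤
          g.deltaNN μ lam bet Lip LX := by
      have hi := integrable_pathValue (L := L) (A := A) ht H (k + 1)
        (lib.trajectory t L A Γ k y ⊗ₘ lib.historyStep t L A Γ k) (measurable_extend k)
      have hi' : Integrable (fun h => ∫ z, g.pathValue t L A H (k + 1) (extend k (h, z))
          ∂lib.historyStep t L A Γ k h) (lib.trajectory t L A Γ k y) := hi.integral_compProd
      have hk' : Integrable (g.pathValue t L A H k) (lib.trajectory t L A Γ k y) :=
        integrable_pathValue ht H k _ measurable_id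
      rw [lib.trajectory_succ, integral_map (measurable_extend k).aemeasurable
        (g.measurable_pathValue t L A H _).aestronglyMeasurable, Measure.integral_compProd hi,
        ← integral_sub hi' hk']
      simpa using norm_integral_le_of_norm_le_const (μ := lib.trajectory t L A Γ k y)
        (f := fun h => ∫ z, g.pathValue t L A H (k + 1) (extend k (h, z))
          ∂lib.historyStep t L A Γ k h - g.pathValue t L A H k h)
        (.of_forall fun h => abs_integral_pathValue_extend_sub_le (lib := lib) hηq hηP ht hΓ
          hlam hbet hLip hLX hLX1 hk h)
    push_cast
    have := abs_sub_le (∫ ξ, g.pathValue t L A H (k + 1) ξ ∂lib.trajectory t L A Γ (k + 1) y)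
      (∫ ξ, g.pathValue t L A H k ξ ∂lib.trajectory t L A Γ k y)
      (g.Vhat t L A H 0 (g.abs y.1) y.2)
    linarith

/-- The probability of reaching the accepting set is close to the optimal value of the symbolic
model. -/
lemma abs_probReach_sub_le (hηq : 0 < ηq) (hηP : 0 < ηP)
    (ht : ∀ y : X × U, ∀ i j, i ≠ j → t y (g.cellSet i ∩ g.cellSet j) = 0)
    (hΓ : g.IsDPSelection t L A H Γ) (hlam : g.LipschitzInState t μ lam)
    (hbet : g.LipschitzInAction t μ bet) (hLip : lib.LipschitzNets Lip)
    (hLX : ∀ x ∈ X, ‖x‖ ≤ LX) (hLX1 : 1 ≤ LX) (y : X × S) :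
    |lib.probReach t L A Γ H y - g.Vhat t L A H 0 (g.abs y.1) y.2|
      ≤ H * g.deltaNN μ lam bet Lip LX := by
  set T := {ξ : (i : Finset.Iic H) → X × S | ∃ i, (ξ i).2 ∈ A.acc}
  have e : ∀ ξ, g.pathValue t L A H H ξ = T.indicator 1 ξ := by
    intro ξ
    unfold pathValue
    split_ifs with hξ
    · exact (Set.indicator_of_mem (s := T) hξ 1).symm
    -- At time `H` the symbolic value is the indicator of the accepting set, hence `0` on a path
    -- that never accepted.
    · rw [Set.indicator_of_notMem (s := T) hξ, Vhat, Nat.sub_self]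
      exact Set.indicator_of_notMem (fun hm => hξ ⟨_, hm⟩) _
  have h := abs_integral_pathValue_sub_le (lib := lib) hηq hηP ht hΓ hlam hbet hLip hLX hLX1 y
    le_rfl
  simp_rw [e] at h
  rwa [integral_indicator_one (measurableSet_reach A H)] at h

/-! ### From reachability to satisfaction. -/

/-- Started in the state that the automaton enters when it reads the first label, the closed loop
satisfies the specification with the probability of reaching the accepting set. -/
lemma Library.probSat_eq_probReach {φ : Spec AP} (hA : A.Equivalent φ H) {s₀ : S}
    (hs₀ : s₀ ∈ A.init) (x : X) :
    lib.probSat t L A Γ H φ (x, A.step s₀ (L.label x)) =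
      lib.probReach t L A Γ H (x, A.step s₀ (L.label x)) := by
  refine measureReal_congr ?_
  filter_upwards [lib.ae_trajectory t L A Γ (x, A.step s₀ (L.label x)) H] with ξ hξ
  have hlen : (L.word ξ).length = H + 1 := by simp [Labeling.word]
  have hget : ∀ k (hk : k ≤ H), (L.word ξ)[k]'(by omega) =
      L.label (ξ ⟨k, Finset.mem_Iic.2 hk⟩).1 := by
    intro k hk
    simp [Labeling.word, -List.ofFn_succ]
  -- Reading `k + 1` letters from `s₀` leads to the automaton state at time `k`: the first letter is
  -- already consumed in the starting pair.
  have hrun : ∀ k (hk : k ≤ H), ((L.word ξ).take (k + 1)).foldl A.step s₀ =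
      (ξ ⟨k, Finset.mem_Iic.2 hk⟩).2 := by
    intro k hk
    rw [← List.take_append_getElem (by omega), List.foldl_append, hget k hk]
    induction k with
    | zero => simp [hξ.1]
    | succ k ih =>
      rw [← List.take_append_getElem (by omega), List.foldl_append, hget k (by omega),
        ih (by omega), hξ.2 k hk]
      rfl
  refine propext (((hA s₀ hs₀ _ hlen).symm).trans ⟨?_, ?_⟩)
  · rintro ⟨k, hk, hacc⟩
    have hk' : k ≤ H := by omega
    exact ⟨⟨k, Finset.mem_Iic.2 hk'⟩, hrun k hk' ▸ hacc⟩
  · rintro ⟨⟨k, hk⟩, hacc⟩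
    have hk' := Finset.mem_Iic.1 hk
    exact ⟨k, by omega, (hrun k hk').symm ▸ hacc⟩

end Grid

end NeuroPlan

end

theorem theorem2 {n m N M : ℕ} {S AP : Type*}
    [Fintype S] [MeasurableSpace S] [DiscreteMeasurableSpace S]
    {X : Set (NeuroPlan.E n)} {U : Set (NeuroPlan.E m)} {𝒦 : Set (NeuroPlan.Gain m n)}
    {ηq ηP : ℝ} (hηq : 0 < ηq) (hηP : 0 < ηP)
    -- the partitions, the library of local networks, and the workspace labels
    (g : NeuroPlan.Grid X U 𝒦 ηq ηP N M) (lib : g.Library) (L : g.Labeling AP)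
    -- the initial states and the stochastic kernel, which does not charge shared cell boundaries
    (X₀ : Set X) (t : Kernel (X × U) X) [IsMarkovKernel t]
    (ht : ∀ y : X × U, ∀ i j, i ≠ j → t y (g.cellSet i ∩ g.cellSet j) = 0)
    -- the specification, the time horizon and the automaton
    (φ : NeuroPlan.Spec AP) (H : ℕ) (A : NeuroPlan.MissionDFA S AP) (hA : A.Equivalent φ H)
    -- the activation map computed by dynamic programming
    (Γ : ℕ → Fin N → S → Fin M) (hΓ : g.IsDPSelection t L A H Γ)
    -- the Lipschitz constants and the bound on the state space
    (μ : Measure X) (lam bet : Fin N → X → ℝ) (hlam : g.LipschitzInState t μ lam)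
    (hbet : g.LipschitzInAction t μ bet) (Lip : Fin N → ℝ) (hLip : lib.LipschitzNets Lip)
    (LX : ℝ) (hLX : ∀ x ∈ X, ‖x‖ ≤ LX) (hLX1 : 1 ≤ LX) :
    ∀ x ∈ X₀,
      (∀ s₀ ∈ A.init, ∀ s, s = A.step s₀ (L.label x) →
        |lib.probSat t L A Γ H φ (x, s) - g.Vhat t L A H 0 (g.abs x) s|
          ≤ H * (Fintype.card S : ℝ) * g.deltaNN μ lam bet Lip LX) ∧
      ∀ s : S,
        |lib.probReach t L A Γ H (x, s) - g.Vhat t L A H 0 (g.abs x) s|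
          ≤ H * (Fintype.card S : ℝ) * g.deltaNN μ lam bet Lip LX := by
  intro x _
  have key : ∀ s : S, |lib.probReach t L A Γ H (x, s) - g.Vhat t L A H 0 (g.abs x) s|
      ≤ H * (Fintype.card S : ℝ) * g.deltaNN μ lam bet Lip LX := by
    intro s
    -- The bound without `Z` is already available; `s` witnesses that `S` is nonempty.
    have hcard : (1 : ℝ) ≤ Fintype.card S := by
      exact_mod_cast Fintype.card_pos_iff.2 ⟨s⟩
    have hΔ := NeuroPlan.Grid.deltaNN_nonneg hηq hηP hlam hbet hLip hLX1
    refine (NeuroPlan.Grid.abs_probReach_sub_le hηq hηP ht hΓ hlam hbet hLip hLX hLX1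
      (x, s)).trans ?_
    gcongr
    exact le_mul_of_one_le_right (Nat.cast_nonneg H) hcard
  refine ⟨fun s₀ hs₀ s hs => ?_, key⟩
  subst hs
  rw [NeuroPlan.Grid.Library.probSat_eq_probReach hA hs₀ x]
  exact key _
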